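/- **Theorem (An LMI condition for informativity, AR systems).** Let $m,p,L$ be positive integers, $q=p+m$, and let $T\ge L$. An input-output AR system of order $L$ is $$y(t+L)+P_{L-1}y(t+L-1)+\dots+P_0y(t)=Q_{L-1}u(t+L-1)+\dots+Q_0u(t)+v(t),\qquad t\in\mathbb Z_+,\tag{1}$$ with $P_i\in\mathbb R^{p\times p}$, $Q_i\in\mathbb R^{p\times m}$; its coefficient matrix is $R=[-Q_0\ \ P_0\ \cdots\ -Q_{L-1}\ \ P_{L-1}]\in\mathbb R^{p\times qL}$. A controller is $$u(t+L)+G_{L-1}u(t+L-1)+\dots+G_0u(t)=F_{L-1}y(t+L-1)+\dots+F_0y(t),\qquad t\in\mathbb Z_+,\tag{2}$$ with coefficient matrix $C=[G_0\ \ -F_0\ \cdots\ G_{L-1}\ \ -F_{L-1}]\in\mathbb R^{m\times qL}$. It stabilizes (1) if all solutions $z=\operatorname{col}(u,y)$ of the closed loop, i.e. of (2) together with (1) for $v=0$, tend to zero as $t\to\infty$. *Noise model.* Let $\Pi=\begin{bmatrix}\Pi_{11}&\Pi_{12}\\ \Pi_{21}&\Pi_{22}\end{bmatrix}$ be a real symmetric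 matrix of size $p+(T-L+1)$ with $\Pi_{22}\le 0$, $\Pi_{11}-\Pi_{12}\Pi_{22}^{\dagger}\Pi_{21}\ge 0$ and $\ker\Pi_{22}\subseteq\ker\Pi_{12}$, where $\dagger$ is the Moore-Penrose inverse. A noise signal $v$ is admissible if $V=[v(0)\ \cdots\ v(T-L)]$ satisfies $\begin{bmatrix}I\\V^\top\end{bmatrix}^{\top}\Pi\begin{bmatrix}I\\V^\top\end{bmatrix}\ge 0$. *Data.* Let $u(0),\dots,u(T)\in\mathbb R^m$, $y(0),\dots,y(T)\in\mathbb R^p$. A system (1) is consistent with the data if the data are samples on $[0,T]$ of a solution of (1) for some admissible $v$. Put $z(t)=\operatorname{col}(u(t),y(t))$, $$H_1(z)=\begin{bmatrix}z(0)&\cdots&z(T-L)\\ \vdots&&\vdots\\ z(L-1)&\cdots&z(T-1)\end{bmatrix},\quad H_2(z)=[y(L)\ \cdots\ y(T)],\quad N=\begin{bmatrix}I&H_2(z)\\0&H_1(z)\end{bmatrix}\Pi\begin{bmatrix}I&H_2(z)\\0&H_1(z)\end{bmatrix}^{\top}.$$ The data are *informative for quadratic stabilization* if there exist $C\in\mathbb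 R^{m\times qL}$ and a symmetric $\Psi\in\mathbb R^{qL\times qL}$, $\Psi\ge 0$, such that $$\begin{bmatrix}I_{qL}\\-C\\-R\end{bmatrix}^{\top}\left(\begin{bmatrix}0_q&0\\0&\Psi\end{bmatrix}-\begin{bmatrix}\Psi&0\\0&0_q\end{bmatrix}\right)\begin{bmatrix}I_{qL}\\-C\\-R\end{bmatrix}<0$$ for all $R\in\mathbb R^{p\times qL}$ with $\begin{bmatrix}I\\R^\top\end{bmatrix}^{\top}N\begin{bmatrix}I\\R^\top\end{bmatrix}\ge 0$. *Quadratic difference forms.* For a symmetric $\Psi$ with $q\times q$ blocks $\Psi_{k,\ell}$, $0\le k,\ell\le n-1$, let $Q_\Psi(z)(t)=\sum_{k,\ell}z(t+k)^\top\Psi_{k,\ell}\,z(t+\ell)$ and $\nabla\Psi=\begin{bmatrix}0_q&0\\0&\Psi\end{bmatrix}-\begin{bmatrix}\Psi&0\\0&0_q\end{bmatrix}$. $Q_\Psi$ is a Lyapunov function for a closed loop with solution set $\mathcal B$ if, for all $z\in\mathcal B$: $Q_\Psi(z)\ge 0$, $Q_{\nabla\Psi}(z)\le 0$, and $Q_{\nabla\Psi}(z)$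 is the zero function if and only if $z=0$. *Statement.* Suppose that the data are collected from some (unknown) system (1) with admissible noise, i.e. that system is consistent with the data, and that $H_1(z)$ has full row rank $qL$. Let $J=[0_{q(L-1)\times q}\ \ I_{q(L-1)}]$ and $$\bar N=\begin{bmatrix}[0\ \ 0\ \ {-I_p}]&0\\0&I_{qL}\end{bmatrix}^{\top}N\begin{bmatrix}[0\ \ 0\ \ {-I_p}]&0\\0&I_{qL}\end{bmatrix},\qquad [0\ \ 0\ \ {-I_p}]\in\mathbb R^{p\times qL}.$$ Then the data are informative for quadratic stabilization if and only if there exist $D\in\mathbb R^{m\times qL}$ and a symmetric $\Phi\in\mathbb R^{qL\times qL}$ with $\Phi>0$ such that $$\begin{bmatrix}\Phi&-\begin{bmatrix}J\Phi\\D\\0\end{bmatrix}&\begin{bmatrix}J\Phi\\D\\0\end{bmatrix}\\[2mm] -\begin{bmatrix}J\Phi\\D\\0\end{bmatrix}^{\top}&-\Phi&0\\[2mm] \begin{bmatrix}J\Phi\\D\\0\end{bmatrix}^{\top}&0&\Phi\end{bmatrix}-\begin{bmatrix}\bar N&0\\0&0_{qL}\end{bmatrix}>0.\tag{3}$$ In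 that case, for any $D$ and $\Phi>0$ satisfying (3), the controller with coefficient matrix $C=-D\Phi^{-1}$ stabilizes all systems that are consistent with the data, and $Q_\Psi$ with $\Psi=\Phi^{-1}$ is a Lyapunov function for each of the resulting closed loops. -/

import Mathlib

open Matrix Filter Topology

/-! ### Autoregressive systems and controllers -/

/-- The index set of `z = col(u, y)`, with `u ∈ ℝ^m` and `y ∈ ℝ^p`. -/
abbrev ZIdx (m p : ℕ) : Type := Fin m ⊕ Fin p

/-- The index set of a stack `col(z₀, …, z_{n-1})` of `n` vectors `z_i = col(u_i, y_i)`: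
`(i, a)` is component `a` of block `i`. -/
abbrev BIdx (n m p : ℕ) : Type := Fin n × ZIdx m p

/-- An input-output system `P(σ) y = Q(σ) u + v` of order `L`, given by the coefficients of
`P(ξ) = I ξ^L + P_{L-1} ξ^{L-1} + ⋯ + P_0` and `Q(ξ) = Q_{L-1} ξ^{L-1} + ⋯ + Q_0`. -/
structure ARSystem (m p L : ℕ) where
  P : Fin L → Matrix (Fin p) (Fin p) ℝ
  Q : Fin L → Matrix (Fin p) (Fin m) ℝ

/-- A feedback controller `G(σ) u = F(σ) y`, given by the coefficients of
`G(ξ) = I ξ^L + G_{L-1} ξ^{L-1} + ⋯ + G_0` and `F(ξ) = F_{L-1} ξ^{L-1} + ⋯ + F_0`. -/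
structure ARController (m p L : ℕ) where
  G : Fin L → Matrix (Fin m) (Fin m) ℝ
  F : Fin L → Matrix (Fin m) (Fin p) ℝ

/-- `y(t+L) + ∑ P_i y(t+i) = ∑ Q_i u(t+i) + v(t)` for all `t ∈ ℤ₊`. -/
def ARSystem.IsSolution {m p L : ℕ} (S : ARSystem m p L)
    (u : ℕ → Fin m → ℝ) (y v : ℕ → Fin p → ℝ) : Prop :=
  ∀ t : ℕ, y (t + L) + ∑ i : Fin L, S.P i *ᵥ y (t + i) = ∑ i : Fin L, S.Q i *ᵥ u (t + i) + v t

/-- `u(t+L) + ∑ G_i u(t+i) = ∑ F_i y(t+i)` for all `t ∈ ℤ₊`. -/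
def ARController.IsSolution {m p L : ℕ} (K : ARController m p L)
    (u : ℕ → Fin m → ℝ) (y : ℕ → Fin p → ℝ) : Prop :=
  ∀ t : ℕ, u (t + L) + ∑ i : Fin L, K.G i *ᵥ u (t + i) = ∑ i : Fin L, K.F i *ᵥ y (t + i)

/-- The controller with coefficient matrix `C = [G_0  -F_0  G_1  -F_1  ⋯  G_{L-1}  -F_{L-1}]`. -/
def ARController.ofCoeff {m p L : ℕ} (C : Matrix (Fin m) (BIdx L m p) ℝ) :
    ARController m p L where
  G i := Matrix.of fun a b => C a (i, Sum.inl b)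
  F i := Matrix.of fun a b => -C a (i, Sum.inr b)

/-- The behavior of the autonomous closed loop `G(σ) u = F(σ) y`, `P(σ) y = Q(σ) u`: all
`z = col(u, y)` on `ℤ₊` satisfying both equations. -/
def closedLoopBehavior {m p L : ℕ} (K : ARController m p L) (S : ARSystem m p L) :
    Set (ℕ → ZIdx m p → ℝ) :=
  {z | K.IsSolution (fun t a => z t (Sum.inl a)) (fun t b => z t (Sum.inr b)) ∧
    S.IsSolution (fun t a => z t (Sum.inl a)) (fun t b => z t (Sum.inr b)) 0}

/-- `K` is a stabilizing controller for `S`: all closed loop solutions tend to zero. -/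
def ARController.Stabilizes {m p L : ℕ} (K : ARController m p L) (S : ARSystem m p L) : Prop :=
  ∀ z ∈ closedLoopBehavior K S, Tendsto z atTop (𝓝 0)

/-! ### Quadratic difference forms -/

/-- `Q_Ψ(z)(t) = ∑_{k,l} z(t+k)ᵀ Ψ_{k,l} z(t+l)`, where `Ψ` has `n × n` blocks. -/
def qdf {n m p : ℕ} (Ψ : Matrix (BIdx n m p) (BIdx n m p) ℝ) (z : ℕ → ZIdx m p → ℝ) (t : ℕ) : ℝ :=
  ∑ k : Fin n, ∑ l : Fin n,
    z (t + k) ⬝ᵥ ((Matrix.of fun a b => Ψ (k, a) (l, b)) *ᵥ z (t + l))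

/-- `diag(0_q, Ψ)`. -/
def padFirst {n m p : ℕ} (Ψ : Matrix (BIdx n m p) (BIdx n m p) ℝ) :
    Matrix (BIdx (n + 1) m p) (BIdx (n + 1) m p) ℝ :=
  Matrix.of fun r c =>
    Fin.cases 0 (fun i : Fin n => Fin.cases 0 (fun j : Fin n => Ψ (i, r.2) (j, c.2)) c.1) r.1

/-- `diag(Ψ, 0_q)`. -/
def padLast {n m p : ℕ} (Ψ : Matrix (BIdx n m p) (BIdx n m p) ℝ) :
    Matrix (BIdx (n + 1) m p) (BIdx (n + 1) m p) ℝ :=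
  Matrix.of fun r c =>
    Fin.lastCases 0
      (fun i : Fin n => Fin.lastCases 0 (fun j : Fin n => Ψ (i, r.2) (j, c.2)) c.1) r.1

/-- `∇Ψ = diag(0_q, Ψ) - diag(Ψ, 0_q)`, the coefficient matrix of the rate of change of `Q_Ψ`. -/
def nablaQ {n m p : ℕ} (Ψ : Matrix (BIdx n m p) (BIdx n m p) ℝ) :
    Matrix (BIdx (n + 1) m p) (BIdx (n + 1) m p) ℝ :=
  padFirst Ψ - padLast Ψ

/-- `Q_Ψ` is a Lyapunov function on the behavior `B`: `Q_Ψ ≥ 0` on `B` and `Q_{∇Ψ} < 0` on `B`.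
The latter means that `Q_{∇Ψ}(z) ≤ 0` for all `z ∈ B`, and that for `z ∈ B` the function
`Q_{∇Ψ}(z)` is zero if and only if `z = 0`. -/
def IsLyapunovOn {n m p : ℕ} (Ψ : Matrix (BIdx n m p) (BIdx n m p) ℝ)
    (B : Set (ℕ → ZIdx m p → ℝ)) : Prop :=
  (∀ z ∈ B, ∀ t, 0 ≤ qdf Ψ z t) ∧
    (∀ z ∈ B, ∀ t, qdf (nablaQ Ψ) z t ≤ 0) ∧
    (∀ z ∈ B, (∀ t, qdf (nablaQ Ψ) z t = 0) ↔ z = 0)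

/-! ### Noise model and data -/

/-- `X` is the Moore-Penrose pseudo-inverse of `A`. -/
def IsMoorePenrose {r s : Type*} [Fintype r] [Fintype s]
    (A : Matrix r s ℝ) (X : Matrix s r ℝ) : Prop :=
  A * X * A = A ∧ X * A * X = X ∧ (A * X)ᵀ = A * X ∧ (X * A)ᵀ = X * A

/-- The class `𝚷_{q,r}`: symmetric `Θ` with `Θ₂₂ ≤ 0`, generalized Schur complement
`Θ₁₁ - Θ₁₂ Θ₂₂† Θ₂₁ ≥ 0`, and `ker Θ₂₂ ⊆ ker Θ₁₂`. -/
def IsQMIClass {q r : Type*} [Fintype q] [Fintype r] (Θ : Matrix (q ⊕ r) (q ⊕ r) ℝ) : Prop :=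
  Θ.IsSymm ∧ (-Θ.toBlocks₂₂).PosSemidef ∧
    (∃ X : Matrix r r ℝ, IsMoorePenrose Θ.toBlocks₂₂ X ∧
      (Θ.toBlocks₁₁ - Θ.toBlocks₁₂ * X * Θ.toBlocks₂₁).PosSemidef) ∧
    ∀ x : r → ℝ, Θ.toBlocks₂₂ *ᵥ x = 0 → Θ.toBlocks₁₂ *ᵥ x = 0

/-- The quadratic matrix inequality `[I; Wᵀ]ᵀ Θ [I; Wᵀ] ≥ 0`, for `W ∈ ℝ^{q × r}`. -/
def SatisfiesQMI {q r : Type*} [Fintype q] [Fintype r] [DecidableEq q]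
    (Θ : Matrix (q ⊕ r) (q ⊕ r) ℝ) (W : Matrix q r ℝ) : Prop :=
  ((Matrix.fromRows (1 : Matrix q q ℝ) Wᵀ)ᵀ * Θ * Matrix.fromRows (1 : Matrix q q ℝ) Wᵀ).PosSemidef

/-- The matrix `V = [v(0)  v(1)  ⋯  v(T-L)]` of noise samples. -/
def noiseMatrix {p : ℕ} (L T : ℕ) (v : ℕ → Fin p → ℝ) : Matrix (Fin p) (Fin (T - L + 1)) ℝ :=
  Matrix.of fun a j => v j a

/-- The data `u(0), …, u(T), y(0), …, y(T)` are samples of a trajectory of the system `S` for some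
noise signal `v` whose samples `v(0), …, v(T-L)` satisfy the noise QMI given by `Θ`. -/
def IsConsistent {m p L T : ℕ}
    (Θ : Matrix (Fin p ⊕ Fin (T - L + 1)) (Fin p ⊕ Fin (T - L + 1)) ℝ)
    (u : Fin (T + 1) → Fin m → ℝ) (y : Fin (T + 1) → Fin p → ℝ) (S : ARSystem m p L) : Prop :=
  ∃ (us : ℕ → Fin m → ℝ) (ys v : ℕ → Fin p → ℝ),
    S.IsSolution us ys v ∧ (∀ t : Fin (T + 1), us t = u t) ∧ (∀ t : Fin (T + 1), ys t = y t) ∧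
      SatisfiesQMI Θ (noiseMatrix L T v)

/-- `H₁(z)`: block row `i ∈ {0, …, L-1}` is `[z(i)  z(i+1)  ⋯  z(i+T-L)]`, with
`z(t) = col(u(t), y(t))`. -/
def hankelOne {m p L T : ℕ} (hLT : L ≤ T)
    (u : Fin (T + 1) → Fin m → ℝ) (y : Fin (T + 1) → Fin p → ℝ) :
    Matrix (BIdx L m p) (Fin (T - L + 1)) ℝ :=
  Matrix.of fun r j =>
    Sum.elim (u ⟨r.1 + j, by omega⟩) (y ⟨r.1 + j, by omega⟩) r.2

/-- `H₂(z) = [y(L)  y(L+1)  ⋯  y(T)]`. -/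
def hankelTwo {p L T : ℕ} (hLT : L ≤ T) (y : Fin (T + 1) → Fin p → ℝ) :
    Matrix (Fin p) (Fin (T - L + 1)) ℝ :=
  Matrix.of fun a j => y ⟨L + j, by omega⟩ a

/-- The block matrix `[I  H₂(z); 0  H₁(z)]`. -/
def dataBlock {m p L T : ℕ} (hLT : L ≤ T)
    (u : Fin (T + 1) → Fin m → ℝ) (y : Fin (T + 1) → Fin p → ℝ) :
    Matrix (Fin p ⊕ BIdx L m p) (Fin p ⊕ Fin (T - L + 1)) ℝ :=
  Matrix.fromBlocks 1 (hankelTwo hLT y) 0 (hankelOne hLT u y)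

/-- `N = [I H₂; 0 H₁] Θ [I H₂; 0 H₁]ᵀ`. -/
def dataN {m p L T : ℕ} (hLT : L ≤ T)
    (Θ : Matrix (Fin p ⊕ Fin (T - L + 1)) (Fin p ⊕ Fin (T - L + 1)) ℝ)
    (u : Fin (T + 1) → Fin m → ℝ) (y : Fin (T + 1) → Fin p → ℝ) :
    Matrix (Fin p ⊕ BIdx L m p) (Fin p ⊕ BIdx L m p) ℝ :=
  dataBlock hLT u y * Θ * (dataBlock hLT u y)ᵀ

/-! ### Informativity and the linear matrix inequality -/

/-- The `q(L+1) × qL` matrix `[I_{qL}; -C; -R]`. -/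
def loopMatrix {m p L : ℕ} (C : Matrix (Fin m) (BIdx L m p) ℝ) (R : Matrix (Fin p) (BIdx L m p) ℝ) :
    Matrix (BIdx (L + 1) m p) (BIdx L m p) ℝ :=
  Matrix.of fun r c =>
    Fin.lastCases (Sum.elim (fun a => -C a c) (fun b => -R b c) r.2)
      (fun i : Fin L => (1 : Matrix (BIdx L m p) (BIdx L m p) ℝ) (i, r.2) c) r.1

/-- Informativity for quadratic stabilization: there are `C` and `Ψ ≥ 0` such that
`[I; -C; -R]ᵀ (diag(0, Ψ) - diag(Ψ, 0)) [I; -C; -R] < 0` for all coefficient matrices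
`R = [-Q_0  P_0  ⋯  -Q_{L-1}  P_{L-1}]` satisfying `[I; Rᵀ]ᵀ N [I; Rᵀ] ≥ 0`. -/
def IsInformative {m p L T : ℕ} (hLT : L ≤ T)
    (Θ : Matrix (Fin p ⊕ Fin (T - L + 1)) (Fin p ⊕ Fin (T - L + 1)) ℝ)
    (u : Fin (T + 1) → Fin m → ℝ) (y : Fin (T + 1) → Fin p → ℝ) : Prop :=
  ∃ (C : Matrix (Fin m) (BIdx L m p) ℝ) (Ψ : Matrix (BIdx L m p) (BIdx L m p) ℝ),
    Ψ.PosSemidef ∧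
      ∀ R : Matrix (Fin p) (BIdx L m p) ℝ, SatisfiesQMI (dataN hLT Θ u y) R →
        (-((loopMatrix C R)ᵀ * nablaQ Ψ * loopMatrix C R)).PosDef

/-- The block column `[X; Y; W]` with `q(L-1) + m + p = qL` rows. -/
def blockCol {m p L : ℕ} {s : Type*} (X : Matrix (BIdx (L - 1) m p) s ℝ) (Y : Matrix (Fin m) s ℝ)
    (W : Matrix (Fin p) s ℝ) : Matrix (BIdx L m p) s ℝ :=
  Matrix.of fun r c =>
    if h : (r.1 : ℕ) < L - 1 then X (⟨r.1, h⟩, r.2) c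
    else Sum.elim (fun a => Y a c) (fun b => W b c) r.2

/-- The `q(L-1) × qL` matrix `J = [0  I_{q(L-1)}]`. -/
def shiftJ (m p L : ℕ) : Matrix (BIdx (L - 1) m p) (BIdx L m p) ℝ :=
  Matrix.of fun r c => if (c.1 : ℕ) = r.1 + 1 ∧ c.2 = r.2 then 1 else 0

/-- The `p × qL` matrix `[0  0  -I_p]`. -/
def selE (m p L : ℕ) : Matrix (Fin p) (BIdx L m p) ℝ :=
  (blockCol (L := L) (m := m) 0 0 (-1 : Matrix (Fin p) (Fin p) ℝ))ᵀ

/-- The block matrix `diag([0 0 -I_p], I_{qL})`. -/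
def selBlock (m p L : ℕ) : Matrix (Fin p ⊕ BIdx L m p) (BIdx L m p ⊕ BIdx L m p) ℝ :=
  Matrix.fromBlocks (selE m p L) 0 0 1

/-- `N̄ = diag([0 0 -I_p], I_{qL})ᵀ N diag([0 0 -I_p], I_{qL})`. -/
def dataNbar {m p L T : ℕ} (hLT : L ≤ T)
    (Θ : Matrix (Fin p ⊕ Fin (T - L + 1)) (Fin p ⊕ Fin (T - L + 1)) ℝ)
    (u : Fin (T + 1) → Fin m → ℝ) (y : Fin (T + 1) → Fin p → ℝ) :
    Matrix (BIdx L m p ⊕ BIdx L m p) (BIdx L m p ⊕ BIdx L m p) ℝ :=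
  (selBlock m p L)ᵀ * dataN hLT Θ u y * selBlock m p L

/-- The linear matrix inequality in `Φ` and `D`: with `B = [JΦ; D; 0]`,
`[Φ, -B, B; -Bᵀ, -Φ, 0; Bᵀ, 0, Φ] - diag(N̄, 0) > 0`. -/
def SatisfiesLMI {m p L T : ℕ} (hLT : L ≤ T)
    (Θ : Matrix (Fin p ⊕ Fin (T - L + 1)) (Fin p ⊕ Fin (T - L + 1)) ℝ)
    (u : Fin (T + 1) → Fin m → ℝ) (y : Fin (T + 1) → Fin p → ℝ)
    (D : Matrix (Fin m) (BIdx L m p) ℝ) (Φ : Matrix (BIdx L m p) (BIdx L m p) ℝ) : Prop :=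
  (Matrix.fromBlocks
      (Matrix.fromBlocks Φ (-blockCol (shiftJ m p L * Φ) D 0)
        (-(blockCol (shiftJ m p L * Φ) D 0)ᵀ) (-Φ))
      (Matrix.fromRows (blockCol (shiftJ m p L * Φ) D 0) 0)
      (Matrix.fromCols (blockCol (shiftJ m p L * Φ) D 0)ᵀ 0)
      Φ
    - Matrix.fromBlocks (dataNbar hLT Θ u y) 0 0 0).PosDef

/-! Write the companion matrix [J; -C; -R] as A₀ + E R with E = [0; 0; -I]. Informativity says that
one form Ψ strictly decreases along A₀ + E R for every solution R of the QMI of N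
(`quad_loopMatrix`). This forces Ψ > 0, and by inversion Φ = Ψ⁻¹ strictly decreases along the
transposes A₀ᵀ + RᵀEᵀ (`quad_inv_mulVec_lt`).

A common Ψ also forces N₂₂ < 0, since otherwise R could move without bound in a rank-one direction
(`quad_lower_neg_of_lyapunov`). Then N is nonnegative at (Eᵀx, w) exactly when w = RᵀEᵀx for some
solution R (`exists_satisfiesQMI_mulVec_eq`). The quantifier over R thus becomes an implication
between two quadratic forms in (x, w): if (x, w) ≠ 0 and N ≥ 0 at (Eᵀx, w), then Φ(x) - Φ(A₀ᵀx + w)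
> 0. The strict S-lemma (`exists_pos_quad_sub_smul_pos`) turns it into one inequality with a
multiplier α > 0, which a rescaling of Φ absorbs. With D = -CΦ that inequality is the LMI: the third
block only adds the square Φ(A₀ᵀx + s), which vanishes at s = -A₀ᵀx (`posDef_lmi_iff`).

Conversely, evaluating the inequality at w = RᵀEᵀx and inverting gives the decrease of Φ⁻¹ for every
solution R, in particular for every consistent system, and this yields stability
(`stabilizes_and_isLyapunovOn`). -/

/-! ### Quadratic forms of matrices -/

/-- The quadratic form `x ↦ xᵀ M x`. -/
def quad {ι : Type*} [Fintype ι] (M : Matrix ι ι ℝ) (x : ι → ℝ) : ℝ := x ⬝ᵥ (M *ᵥ x)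

section Quad

variable {ι κ : Type*} [Fintype ι] [Fintype κ]

theorem posDef_iff_quad {M : Matrix ι ι ℝ} :
    M.PosDef ↔ M.IsSymm ∧ ∀ x, x ≠ 0 → 0 < quad M x := by
  rw [posDef_iff_dotProduct_mulVec]
  simp [quad, IsSymm, IsHermitian]

theorem posSemidef_iff_quad {M : Matrix ι ι ℝ} :
    M.PosSemidef ↔ M.IsSymm ∧ ∀ x, 0 ≤ quad M x := by
  rw [posSemidef_iff_dotProduct_mulVec]
  simp [quad, IsSymm, IsHermitian]

theorem quad_zero (M : Matrix ι ι ℝ) : quad M 0 = 0 := by simp [quad]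

theorem quad_matrix_add (M N : Matrix ι ι ℝ) (x : ι → ℝ) :
    quad (M + N) x = quad M x + quad N x := by
  simp [quad, add_mulVec, dotProduct_add]

theorem quad_matrix_neg (M : Matrix ι ι ℝ) (x : ι → ℝ) : quad (-M) x = -quad M x := by
  simp [quad, neg_mulVec]

theorem quad_matrix_sub (M N : Matrix ι ι ℝ) (x : ι → ℝ) :
    quad (M - N) x = quad M x - quad N x := by
  simp [quad, sub_mulVec, dotProduct_sub]

theorem quad_matrix_smul (a : ℝ) (M : Matrix ι ι ℝ) (x : ι → ℝ) :
    quad (a • M) x = a * quad M x := by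
  simp [quad, smul_mulVec]

theorem quad_one [DecidableEq ι] (x : ι → ℝ) : quad (1 : Matrix ι ι ℝ) x = x ⬝ᵥ x := by
  simp [quad]

theorem quad_transpose_mul_mul (M : Matrix ι ι ℝ) (B : Matrix ι κ ℝ) (x : κ → ℝ) :
    quad (Bᵀ * M * B) x = quad M (B *ᵥ x) := by
  simp only [quad, ← mulVec_mulVec, dotProduct_mulVec, vecMul_transpose]

theorem quad_mul_mul_transpose (M : Matrix ι ι ℝ) (B : Matrix κ ι ℝ) (x : κ → ℝ) :
    quad (B * M * Bᵀ) x = quad M (Bᵀ *ᵥ x) := by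
  simpa using quad_transpose_mul_mul M Bᵀ x

theorem isSymm_transpose_mul_mul {κ : Type*} {M : Matrix ι ι ℝ} (hM : M.IsSymm) (B : Matrix ι κ ℝ) :
    (Bᵀ * M * B).IsSymm := by
  simp [IsSymm, transpose_mul, hM.eq, Matrix.mul_assoc]

theorem isSymm_mul_mul_transpose {κ : Type*} {M : Matrix ι ι ℝ} (hM : M.IsSymm) (B : Matrix κ ι ℝ) :
    (B * M * Bᵀ).IsSymm := by
  simpa using isSymm_transpose_mul_mul hM Bᵀ

theorem Matrix.IsSymm.dotProduct_mulVec_comm {M : Matrix ι ι ℝ} (hM : M.IsSymm) (x y : ι → ℝ) :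
    x ⬝ᵥ (M *ᵥ y) = y ⬝ᵥ (M *ᵥ x) := by
  rw [dotProduct_mulVec, ← mulVec_transpose, hM.eq, dotProduct_comm]

theorem quad_add {M : Matrix ι ι ℝ} (hM : M.IsSymm) (x y : ι → ℝ) :
    quad M (x + y) = quad M x + 2 * (x ⬝ᵥ (M *ᵥ y)) + quad M y := by
  simp only [quad, mulVec_add, dotProduct_add, add_dotProduct]
  rw [hM.dotProduct_mulVec_comm y x]
  ring

theorem quad_smul (M : Matrix ι ι ℝ) (a : ℝ) (x : ι → ℝ) : quad M (a • x) = a ^ 2 * quad M x := by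
  simp [quad, mulVec_smul]
  ring

theorem quad_neg (M : Matrix ι ι ℝ) (x : ι → ℝ) : quad M (-x) = quad M x := by
  simp [quad, mulVec_neg]

theorem quad_add_smul {M : Matrix ι ι ℝ} (hM : M.IsSymm) (x y : ι → ℝ) (t : ℝ) :
    quad M (x + t • y) = quad M x + 2 * t * (x ⬝ᵥ (M *ᵥ y)) + t ^ 2 * quad M y := by
  rw [quad_add hM, quad_smul, mulVec_smul, dotProduct_smul, smul_eq_mul]
  ring

theorem continuous_quad (M : Matrix ι ι ℝ) : Continuous (quad M) := by
  unfold quad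
  simp only [dotProduct, mulVec]
  fun_prop

/-- The ambient norm is the sup norm, so the Euclidean sphere is shown closed and contained in the
sup-norm unit ball. -/
theorem isCompact_unitSphere : IsCompact {x : ι → ℝ | x ⬝ᵥ x = 1} := by
  refine Metric.isCompact_of_isClosed_isBounded
    (isClosed_eq (by simp only [dotProduct]; fun_prop) continuous_const) ?_
  refine (Metric.isBounded_closedBall (x := (0 : ι → ℝ)) (r := 1)).subset fun x hx => ?_
  rw [mem_closedBall_zero_iff, pi_norm_le_iff_of_nonneg zero_le_one]
  intro i
  have h : x i * x i ≤ x ⬝ᵥ x :=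
    Finset.single_le_sum (f := fun i => x i * x i) (fun j _ => mul_self_nonneg (x j))
      (Finset.mem_univ i)
  rw [Set.mem_ofPred_eq.mp hx] at h
  rw [Real.norm_eq_abs, abs_le]
  constructor <;> nlinarith

theorem dotProduct_self_pos' {x : ι → ℝ} (hx : x ≠ 0) : 0 < x ⬝ᵥ x := by
  have h : 0 ≤ x ⬝ᵥ x := Finset.sum_nonneg fun i _ => mul_self_nonneg (x i)
  exact lt_of_le_of_ne h fun h' => hx (dotProduct_self_eq_zero.mp h'.symm)

theorem ne_zero_of_dotProduct_self {x : ι → ℝ} (hx : x ⬝ᵥ x = 1) : x ≠ 0 := by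
  rintro rfl
  simp at hx

theorem exists_pos_smul_unit {x : ι → ℝ} (hx : x ≠ 0) :
    ∃ a : ℝ, 0 < a ∧ (a • x) ⬝ᵥ (a • x) = 1 := by
  have h := dotProduct_self_pos' hx
  refine ⟨(√(x ⬝ᵥ x))⁻¹, by positivity, ?_⟩
  have h2 := Real.mul_self_sqrt h.le
  have h3 : √(x ⬝ᵥ x) ≠ 0 := (Real.sqrt_pos.mpr h).ne'
  simp only [smul_dotProduct, dotProduct_smul, smul_eq_mul]
  nth_rewrite 3 [← h2]
  field_simp

/-- A positive definite form dominates a positive multiple of the square norm. -/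
theorem exists_pos_mul_le_quad {M : Matrix ι ι ℝ} (hM : ∀ x, x ≠ 0 → 0 < quad M x) :
    ∃ c : ℝ, 0 < c ∧ ∀ x, c * (x ⬝ᵥ x) ≤ quad M x := by
  rcases ({x : ι → ℝ | x ⬝ᵥ x = 1}).eq_empty_or_nonempty with he | hne
  · refine ⟨1, one_pos, fun x => ?_⟩
    by_cases hx : x = 0
    · simp [hx, quad_zero]
    · obtain ⟨a, -, ha⟩ := exists_pos_smul_unit hx
      exact absurd (show a • x ∈ {x : ι → ℝ | x ⬝ᵥ x = 1} from ha) (by simp [he])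
  · obtain ⟨z, hz, hmin⟩ := isCompact_unitSphere.exists_isMinOn hne (continuous_quad M).continuousOn
    refine ⟨quad M z, hM z (ne_zero_of_dotProduct_self hz), fun x => ?_⟩
    by_cases hx : x = 0
    · simp [hx, quad_zero]
    · obtain ⟨a, ha, hax⟩ := exists_pos_smul_unit hx
      have h1 : quad M z ≤ quad M (a • x) := hmin (show (a • x) ⬝ᵥ (a • x) = 1 from hax)
      rw [quad_smul] at h1
      simp only [smul_dotProduct, dotProduct_smul, smul_eq_mul] at hax
      have h2 : a ^ 2 * (quad M z * (x ⬝ᵥ x)) ≤ a ^ 2 * quad M x := by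
        calc a ^ 2 * (quad M z * (x ⬝ᵥ x)) = quad M z * (a * (a * (x ⬝ᵥ x))) := by ring
          _ = quad M z := by rw [hax, mul_one]
          _ ≤ _ := h1
      exact le_of_mul_le_mul_left h2 (by positivity)

/-! ### The strict S-lemma -/

/-- The ratio `M / N` on `{N < 0}` lies below the ratio `M / N` on `{N > 0}`. -/
theorem quad_ratio_lt {M N : Matrix ι ι ℝ} (hM : M.IsSymm) (hN : N.IsSymm)
    (h : ∀ x, x ≠ 0 → quad N x = 0 → 0 < quad M x) {x y : ι → ℝ} (hx : quad N x < 0)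
    (hy : 0 < quad N y) : quad M y / quad N y * quad N x < quad M x := by
  set c := quad M y / quad N y with hc
  have hcy : quad M y = c * quad N y := by rw [hc]; field_simp
  set b := x ⬝ᵥ (N *ᵥ y) with hb
  set d := x ⬝ᵥ (M *ᵥ y) with hd
  -- `M - c N` vanishes at `y`, so along the line `x + t y` it is affine in `t` with slope `2 (d - c
  -- b)`. At a root of `N` on this line it equals `M > 0`; if `t` times the slope is nonpositive,
  -- its value at `x` is then positive.
  have key : ∀ t : ℝ, quad N x + 2 * t * b + t ^ 2 * quad N y = 0 → t * (d - c * b) ≤ 0 →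
      c * quad N x < quad M x := by
    intro t ht hs
    have hne : x + t • y ≠ 0 := by
      intro h0
      have hxt : x = (-t) • y := by rw [neg_smul]; exact eq_neg_of_add_eq_zero_left h0
      have : quad N x = (-t) ^ 2 * quad N y := by rw [hxt, quad_smul]
      nlinarith [mul_nonneg (sq_nonneg (-t)) hy.le]
    have h0 : quad N (x + t • y) = 0 := by rw [quad_add_smul hN, ← hb]; exact ht
    have h1 := h _ hne h0
    rw [quad_add_smul hM, ← hd, hcy] at h1
    have h2 : c * (quad N x + 2 * t * b + t ^ 2 * quad N y) = 0 := by rw [ht, mul_zero]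
    linarith
  -- The product of the two roots is `N x / N y < 0`, so there is a root of each sign and the one
  -- that suits the slope can be chosen.
  set Δ := b ^ 2 - quad N x * quad N y with hΔ
  have hΔb : b ^ 2 < Δ := by nlinarith [mul_pos (neg_pos.mpr hx) hy]
  have hs2 : √Δ ^ 2 = Δ := Real.sq_sqrt ((sq_nonneg b).trans hΔb.le)
  have habs : |b| < √Δ := by
    rw [← Real.sqrt_sq_eq_abs]
    exact Real.sqrt_lt_sqrt (sq_nonneg b) hΔb
  obtain ⟨hb1, hb2⟩ := abs_lt.mp habs
  have root : ∀ r : ℝ, r ^ 2 = Δ →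
      quad N x + 2 * ((r - b) / quad N y) * b + ((r - b) / quad N y) ^ 2 * quad N y = 0 := by
    intro r hr
    field_simp
    nlinarith
  rcases le_total (d - c * b) 0 with h1 | h1
  · refine key _ (root (√Δ) hs2) (mul_nonpos_of_nonneg_of_nonpos ?_ h1)
    exact div_nonneg (by linarith) hy.le
  · refine key _ (root (-√Δ) (by rw [neg_sq, hs2])) (mul_nonpos_of_nonpos_of_nonneg ?_ h1)
    exact div_nonpos_of_nonpos_of_nonneg (by linarith) hy.le

/-- Strict S-lemma: if `M > 0` on `{N ≥ 0} \ {0}`, and `N` is somewhere nonnegative and `M` is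
somewhere negative, then `M - α N > 0` for some `α > 0`. -/
theorem exists_pos_quad_sub_smul_pos {M N : Matrix ι ι ℝ} (hM : M.IsSymm) (hN : N.IsSymm)
    (h : ∀ x, x ≠ 0 → 0 ≤ quad N x → 0 < quad M x) {x₀ x₁ : ι → ℝ} (hx₀ : x₀ ≠ 0)
    (h₀ : 0 ≤ quad N x₀) (h₁ : quad M x₁ < 0) :
    ∃ α : ℝ, 0 < α ∧ ∀ x, x ≠ 0 → 0 < quad (M - α • N) x := by
  classical
  -- The hypothesis survives a small enlargement of `N`: on the compact set of unit vectors with `M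
  -- ≤ 0`, `N` has a negative maximum, and `δ` is half its absolute value.
  obtain ⟨δ, hδ, hMδ⟩ : ∃ δ : ℝ, 0 < δ ∧
      ∀ x, x ≠ 0 → 0 ≤ quad (N + δ • 1) x → 0 < quad M x := by
    have hK : IsCompact ({x : ι → ℝ | x ⬝ᵥ x = 1} ∩ {x | quad M x ≤ 0}) :=
      isCompact_unitSphere.inter_right (isClosed_le (continuous_quad M) continuous_const)
    have hne : ({x : ι → ℝ | x ⬝ᵥ x = 1} ∩ {x | quad M x ≤ 0}).Nonempty := by
      have hx₁ : x₁ ≠ 0 := by rintro rfl; simp [quad_zero] at h₁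
      obtain ⟨a, ha, hax⟩ := exists_pos_smul_unit hx₁
      refine ⟨a • x₁, hax, ?_⟩
      rw [Set.mem_ofPred_eq, quad_smul]
      exact mul_nonpos_of_nonneg_of_nonpos (sq_nonneg a) h₁.le
    obtain ⟨z, ⟨hz1, hz2⟩, hmax⟩ := hK.exists_isMaxOn hne (continuous_quad N).continuousOn
    have hz : quad N z < 0 := by
      by_contra hcon
      exact absurd (h z (ne_zero_of_dotProduct_self hz1) (not_lt.mp hcon)) (not_lt.mpr hz2)
    refine ⟨-quad N z / 2, by linarith, fun x hx hq => ?_⟩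
    by_contra hcon
    obtain ⟨a, ha, hax⟩ := exists_pos_smul_unit hx
    have hmem : a • x ∈ {x : ι → ℝ | x ⬝ᵥ x = 1} ∩ {x | quad M x ≤ 0} := by
      refine ⟨hax, ?_⟩
      rw [Set.mem_ofPred_eq, quad_smul]
      exact mul_nonpos_of_nonneg_of_nonpos (sq_nonneg a) (not_lt.mp hcon)
    have h2 : quad N (a • x) ≤ quad N z := hmax hmem
    have h3 : 0 ≤ quad (N + (-quad N z / 2) • 1) (a • x) := by
      rw [quad_smul]; exact mul_nonneg (sq_nonneg a) hq
    rw [quad_matrix_add, quad_matrix_smul, quad_one, hax] at h3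
    linarith
  set Nδ := N + δ • (1 : Matrix ι ι ℝ) with hNδ
  have hNδs : Nδ.IsSymm := by simp [hNδ, IsSymm, hN.eq]
  have hNδx : ∀ x, quad Nδ x = quad N x + δ * (x ⬝ᵥ x) := fun x => by
    rw [hNδ, quad_matrix_add, quad_matrix_smul, quad_one]
  set S : Set ℝ := (fun x => quad M x / quad Nδ x) '' {x | 0 < quad Nδ x} with hS
  have hSne : S.Nonempty := by
    refine ⟨_, x₀, ?_, rfl⟩
    rw [Set.mem_ofPred_eq, hNδx]
    have := mul_pos hδ (dotProduct_self_pos' hx₀)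
    linarith
  have hS0 : ∀ s ∈ S, 0 ≤ s := by
    rintro s ⟨x, hx, rfl⟩
    have hx0 : x ≠ 0 := by rintro rfl; simp [quad_zero] at hx
    exact div_nonneg (hMδ x hx0 hx.le).le hx.le
  set α := sInf S with hα
  -- `α` is the infimum of `M / Nδ` over `Nδ > 0`. Where `Nδ < 0` the inequality reverses on
  -- division, and `quad_ratio_lt` makes the ratio there a lower bound of `S`.
  have hle : ∀ x, α * quad Nδ x ≤ quad M x := by
    intro x
    rcases lt_trichotomy (quad Nδ x) 0 with hx | hx | hx
    · rw [← div_le_iff_of_neg hx]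
      refine le_csInf hSne ?_
      rintro s ⟨y, hy, rfl⟩
      rw [div_le_iff_of_neg hx]
      exact (quad_ratio_lt hM hNδs (fun x h1 h2 => hMδ x h1 h2.ge) hx hy).le
    · rw [hx, mul_zero]
      by_cases hx0 : x = 0
      · simp [hx0, quad_zero]
      · exact (hMδ x hx0 hx.ge).le
    · rw [← le_div_iff₀ hx]
      exact csInf_le ⟨0, fun s hs => hS0 s hs⟩ ⟨x, hx, rfl⟩
  have hα0 : 0 < α := by
    refine lt_of_le_of_ne (le_csInf hSne hS0) fun h0 => ?_
    have := hle x₁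
    rw [← h0, zero_mul] at this
    linarith
  refine ⟨α, hα0, fun x hx => ?_⟩
  have h2 := hle x
  rw [hNδx] at h2
  -- The enlargement `δ` pays for strictness: `M - α N = (M - α Nδ) + α δ |x|²`.
  have h3 := mul_pos hα0 (mul_pos hδ (dotProduct_self_pos' hx))
  rw [quad_matrix_sub, quad_matrix_smul]
  linarith

end Quad

/-! ### Quadratic matrix inequalities -/

section QMI

variable {n r : Type*} [Fintype n] [Fintype r]

/-- Cauchy-Schwarz for the semidefinite form `S`: it is nonnegative at `y` minus its `S`-projection
onto `x`. -/
theorem dotProduct_mulVec_sq_le {S : Matrix n n ℝ} (hS : S.IsSymm) (h : ∀ x, 0 ≤ quad S x)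
    {x : n → ℝ} (hx : 0 < quad S x) (y : n → ℝ) :
    (y ⬝ᵥ (S *ᵥ x) / quad S x) ^ 2 * quad S x ≤ quad S y := by
  have h1 := h (y + (-(y ⬝ᵥ (S *ᵥ x) / quad S x)) • x)
  rw [quad_add_smul hS] at h1
  have h2 : y ⬝ᵥ (S *ᵥ x) = y ⬝ᵥ (S *ᵥ x) / quad S x * quad S x := by field_simp
  rw [h2] at h1
  set c := y ⬝ᵥ (S *ᵥ x) / quad S x
  rw [mul_div_cancel_right₀ _ hx.ne'] at h1
  linarith

/-- Discrete-time Lyapunov inequalities for `Aᵀ` and `A` are equivalent by inversion. -/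
theorem quad_inv_mulVec_lt [DecidableEq n] {Φ A : Matrix n n ℝ} (hΦ : Φ.PosDef)
    (h : ∀ x, x ≠ 0 → quad Φ (Aᵀ *ᵥ x) < quad Φ x) {x : n → ℝ} (hx : x ≠ 0) :
    quad Φ⁻¹ (A *ᵥ x) < quad Φ⁻¹ x := by
  have hdet : IsUnit Φ.det := (isUnit_iff_isUnit_det Φ).mp hΦ.isUnit
  obtain ⟨hsymm, hpos⟩ := posDef_iff_quad.mp hΦ
  obtain ⟨-, hpos'⟩ := posDef_iff_quad.mp hΦ.inv
  set y := Φ⁻¹ *ᵥ (A *ᵥ x) with hy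
  have hΦy : Φ *ᵥ y = A *ᵥ x := by rw [hy, mulVec_mulVec, mul_nonsing_inv _ hdet, one_mulVec]
  have hΦx : Φ *ᵥ (Φ⁻¹ *ᵥ x) = x := by rw [mulVec_mulVec, mul_nonsing_inv _ hdet, one_mulVec]
  have h1 : quad Φ⁻¹ (A *ᵥ x) = quad Φ y := by
    rw [quad, ← hy, quad, hΦy, dotProduct_comm]
  rw [h1]
  by_cases hy0 : y = 0
  · rw [hy0, quad_zero]; exact hpos' x hx
  have h2 := h y hy0
  -- Expanding this square gives `2 Φ(y) ≤ Φ(Aᵀ y) + Φ⁻¹(x)`, because `(Aᵀ y) · x = y · A x = Φ(y)`.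
  -- The hypothesis at `y` bounds `Φ(Aᵀ y)` by `Φ(y)`, strictly.
  have h3 : 0 ≤ quad Φ (Aᵀ *ᵥ y + -(Φ⁻¹ *ᵥ x)) := by
    have := (posSemidef_iff_quad.mp hΦ.posSemidef).2
    exact this _
  rw [quad_add hsymm, quad_neg, mulVec_neg, dotProduct_neg, hΦx] at h3
  have h4 : (Aᵀ *ᵥ y) ⬝ᵥ x = quad Φ y := by
    rw [mulVec_transpose, ← dotProduct_mulVec, ← hΦy, quad]
  have h5 : quad Φ (Φ⁻¹ *ᵥ x) = quad Φ⁻¹ x := by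
    rw [quad, hΦx, quad, dotProduct_comm]
  rw [h4, h5] at h3
  linarith

theorem satisfiesQMI_iff_quad [DecidableEq r] {N : Matrix (r ⊕ n) (r ⊕ n) ℝ} (hN : N.IsSymm)
    (R : Matrix r n ℝ) :
    SatisfiesQMI N R ↔ ∀ ξ, 0 ≤ quad N (Sum.elim ξ (Rᵀ *ᵥ ξ)) := by
  unfold SatisfiesQMI
  rw [posSemidef_iff_quad, and_iff_right (isSymm_transpose_mul_mul hN _)]
  simp [quad_transpose_mul_mul, fromRows_mulVec]

theorem sumElim_add_smul {n r : Type*} (ξ : r → ℝ) (w v : n → ℝ) (c : ℝ) :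
    Sum.elim ξ (w + c • v) = Sum.elim ξ w + c • Sum.elim (0 : r → ℝ) v := by
  ext i
  cases i <;> simp

theorem add_smul_vecMulVec_transpose_mulVec {n : Type*} (R : Matrix r n ℝ) (c : ℝ) (ζ : r → ℝ) (v : n → ℝ)
    (ξ : r → ℝ) : (R + c • vecMulVec ζ v)ᵀ *ᵥ ξ = Rᵀ *ᵥ ξ + (c * (ζ ⬝ᵥ ξ)) • v := by
  rw [transpose_add, add_mulVec, transpose_smul, smul_mulVec, transpose_vecMulVec, mul_smul]
  congr 2
  ext i
  simp [mulVec, vecMulVec_apply, dotProduct, Finset.mul_sum, mul_comm, mul_left_comm]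

/-- If the lower right block of `N` is negative definite and the solution set of the quadratic
matrix inequality is nonempty, then each vector `(ξ, w)` with `(ξ, w)ᵀ N (ξ, w) ≥ 0` is of the
form `(ξ, Rᵀ ξ)` for a solution `R`. -/
theorem exists_satisfiesQMI_mulVec_eq [DecidableEq r] [DecidableEq n]
    {N : Matrix (r ⊕ n) (r ⊕ n) ℝ} (hN : N.IsSymm)
    (hneg : ∀ v : n → ℝ, v ≠ 0 → quad N (Sum.elim 0 v) < 0) {R₁ : Matrix r n ℝ}
    (hR₁ : SatisfiesQMI N R₁) {ξ : r → ℝ} {w : n → ℝ} (h : 0 ≤ quad N (Sum.elim ξ w)) :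
    ∃ R : Matrix r n ℝ, SatisfiesQMI N R ∧ Rᵀ *ᵥ ξ = w := by
  have hblock : fromBlocks N.toBlocks₁₁ N.toBlocks₁₂ N.toBlocks₂₁ N.toBlocks₂₂ = N :=
    fromBlocks_toBlocks N
  have hK : (-N.toBlocks₂₂).PosDef := by
    refine posDef_iff_quad.mpr ⟨?_, fun v hv => ?_⟩
    · rw [IsSymm, transpose_neg]
      congr 1
      ext i j
      exact hN.apply _ _
    · have h1 := hneg v hv
      rw [← hblock, quad, fromBlocks_mulVec] at h1
      rw [quad_matrix_neg]
      simpa [quad] using h1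
  have hdet : IsUnit (N.toBlocks₂₂).det := by
    have := hK.isUnit.neg
    rw [neg_neg] at this
    exact (isUnit_iff_isUnit_det _).mp this
  -- Completing the square: the vectors `(η, G η)` are `N`-orthogonal to all `(0, v)`. The form `S`
  -- below is the Schur complement, nonnegative because `R₁` is a solution and `N ≤ 0` on the
  -- vectors `(0, v)`.
  set G : Matrix n r ℝ := -((N.toBlocks₂₂)⁻¹ * N.toBlocks₂₁) with hG
  have hcross : ∀ (η : r → ℝ) (v : n → ℝ),
      Sum.elim η (G *ᵥ η) ⬝ᵥ (N *ᵥ Sum.elim 0 v) = 0 := by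
    intro η v
    rw [hN.dotProduct_mulVec_comm, ← hblock, fromBlocks_mulVec]
    simp only [Sum.elim_comp_inl, Sum.elim_comp_inr, sumElim_dotProduct_sumElim,
      zero_dotProduct, zero_add, mulVec_mulVec]
    rw [hG, Matrix.mul_neg, ← Matrix.mul_assoc, mul_nonsing_inv _ hdet, Matrix.one_mul,
      neg_mulVec, add_neg_cancel, dotProduct_zero]
  have hsplit : ∀ (η : r → ℝ) (v : n → ℝ) (c : ℝ), quad N (Sum.elim η (G *ᵥ η + c • v)) =
      quad N (Sum.elim η (G *ᵥ η)) + c ^ 2 * quad N (Sum.elim 0 v) := by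
    intro η v c
    rw [sumElim_add_smul, quad_add_smul hN, hcross]
    ring
  set S : Matrix r r ℝ := (fromRows (1 : Matrix r r ℝ) G)ᵀ * N * fromRows (1 : Matrix r r ℝ) G with hS
  have hSs : S.IsSymm := isSymm_transpose_mul_mul hN _
  have hSq : ∀ η, quad S η = quad N (Sum.elim η (G *ᵥ η)) := fun η => by
    rw [hS, quad_transpose_mul_mul, fromRows_mulVec, one_mulVec]
  have hneg' : ∀ v : n → ℝ, quad N (Sum.elim 0 v) ≤ 0 := by
    intro v
    by_cases hv : v = 0
    · rw [hv, Sum.elim_zero_zero, quad_zero]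
    · exact (hneg v hv).le
  have hS0 : ∀ η, 0 ≤ quad S η := by
    intro η
    have h1 := (satisfiesQMI_iff_quad hN R₁).mp hR₁ η
    have h2 := hsplit η (R₁ᵀ *ᵥ η - G *ᵥ η) 1
    rw [one_smul, add_sub_cancel] at h2
    have h3 := hneg' (R₁ᵀ *ᵥ η - G *ᵥ η)
    rw [hSq]
    linarith
  set v := w - G *ᵥ ξ with hv
  have hw : w = G *ᵥ ξ + (1 : ℝ) • v := by rw [hv, one_smul, add_sub_cancel]
  rw [hw, hsplit, ← hSq] at h
  rcases (hS0 ξ).eq_or_lt with h0 | h0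
  · have hv0 : v = 0 := by
      by_contra hcon
      have := hneg v hcon
      linarith
    refine ⟨Gᵀ, (satisfiesQMI_iff_quad hN _).mpr fun η => ?_, ?_⟩
    · rw [transpose_transpose, ← hSq]
      exact hS0 η
    · rw [transpose_transpose, hw, hv0, smul_zero, add_zero]
  -- A rank-one correction of `Gᵀ` whose transpose sends `ξ` to `G ξ + v = w`. Cauchy-Schwarz for
  -- `S` reduces the QMI at every `η` to the given inequality at `ξ`.
  · have hR : ∀ η, (Gᵀ + (quad S ξ)⁻¹ • vecMulVec (S *ᵥ ξ) v)ᵀ *ᵥ η =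
        G *ᵥ η + (η ⬝ᵥ (S *ᵥ ξ) / quad S ξ) • v := fun η => by
      rw [add_smul_vecMulVec_transpose_mulVec, transpose_transpose, dotProduct_comm,
        div_eq_inv_mul]
    refine ⟨_, (satisfiesQMI_iff_quad hN _).mpr fun η => ?_, (hR ξ).trans ?_⟩
    · rw [hR, hsplit, ← hSq]
      have h1 := dotProduct_mulVec_sq_le hSs hS0 h0 η
      have h2 := mul_nonneg (sq_nonneg (η ⬝ᵥ (S *ᵥ ξ) / quad S ξ)) h
      rw [mul_add] at h2
      linarith
    · rw [hw]
      congr 2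
      exact div_self h0.ne'

/-- A common quadratic Lyapunov function for all solutions of a quadratic matrix inequality forces
the lower right block to be negative definite. -/
theorem quad_lower_neg_of_lyapunov [DecidableEq r] {N : Matrix (r ⊕ n) (r ⊕ n) ℝ}
    (hN : N.IsSymm) (hnonpos : ∀ v : n → ℝ, quad N (Sum.elim 0 v) ≤ 0)
    (hker : ∀ v : n → ℝ, quad N (Sum.elim 0 v) = 0 → N *ᵥ Sum.elim 0 v = 0)
    {R₁ : Matrix r n ℝ} (hR₁ : SatisfiesQMI N R₁) {A₀ Ψ : Matrix n n ℝ} {E : Matrix n r ℝ}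
    {ζ : r → ℝ} (hζ : E *ᵥ ζ ≠ 0) (hΨ : Ψ.PosDef)
    (h : ∀ R, SatisfiesQMI N R → ∀ x, x ≠ 0 → quad Ψ ((A₀ + E * R) *ᵥ x) < quad Ψ x)
    {v : n → ℝ} (hv : v ≠ 0) : quad N (Sum.elim 0 v) < 0 := by
  refine lt_of_le_of_ne (hnonpos v) fun h0 => ?_
  obtain ⟨hΨs, hΨp⟩ := posDef_iff_quad.mp hΨ
  -- `(0, v)` lies in the kernel of `N`, so adding any multiple of `ζ vᵀ` to `R₁` leaves the form
  -- unchanged.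
  have hQ : ∀ s : ℝ, SatisfiesQMI N (R₁ + s • vecMulVec ζ v) := by
    intro s
    rw [satisfiesQMI_iff_quad hN]
    intro η
    rw [add_smul_vecMulVec_transpose_mulVec, sumElim_add_smul, quad_add_smul hN, h0, hker v h0,
      dotProduct_zero, mul_zero, mul_zero, add_zero, add_zero]
    exact (satisfiesQMI_iff_quad hN R₁).mp hR₁ η
  have hA : ∀ s : ℝ, (A₀ + E * (R₁ + s • vecMulVec ζ v)) *ᵥ v =
      (A₀ + E * R₁) *ᵥ v + (s * (v ⬝ᵥ v)) • (E *ᵥ ζ) := by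
    intro s
    have : vecMulVec ζ v *ᵥ v = (v ⬝ᵥ v) • ζ := by
      ext i
      simp [mulVec, vecMulVec_apply, dotProduct, Finset.mul_sum, mul_comm, mul_left_comm]
    rw [Matrix.mul_add, ← add_assoc, add_mulVec _ (E * _), ← mulVec_mulVec, smul_mulVec, this,
      smul_smul, mulVec_smul]
  have hvv := dotProduct_self_pos' hv
  have hpos := hΨp _ hζ
  set c := (v ⬝ᵥ v) ^ 2 * quad Ψ (E *ᵥ ζ) with hc
  have hc0 : 0 < c := by positivity
  have hvp := hΨp v hv
  -- With this `s`, the displacement along `E ζ` alone has `Ψ`-value `Ψ(v)`. Adding the inequalities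
  -- for `s` and `-s` cancels the cross term and leaves a negative value of `Ψ`.
  set s := √(quad Ψ v / c) with hs
  have hs2 : s ^ 2 * c = quad Ψ v := by
    rw [hs, Real.sq_sqrt (by positivity)]
    field_simp
  have h1 := h _ (hQ s) v hv
  have h2 := h _ (hQ (-s)) v hv
  rw [hA, quad_add_smul hΨs] at h1 h2
  have h3 : 0 ≤ quad Ψ ((A₀ + E * R₁) *ᵥ v) := (posSemidef_iff_quad.mp hΨ.posSemidef).2 _
  have h4 : (s * (v ⬝ᵥ v)) ^ 2 * quad Ψ (E *ᵥ ζ) = quad Ψ v := by rw [← hs2, hc]; ring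
  have h5 : (-s * (v ⬝ᵥ v)) ^ 2 * quad Ψ (E *ᵥ ζ) = quad Ψ v := by rw [← hs2, hc]; ring
  rw [h4] at h1
  rw [h5] at h2
  linarith

/-- The core of necessity: inversion moves `R` into `w = Rᵀ Eᵀ x`, surjectivity onto the pairs with
`N ≥ 0` removes `R`, and the S-lemma removes the implication. -/
theorem exists_posDef_of_lyapunov [DecidableEq r] [DecidableEq n] {N : Matrix (r ⊕ n) (r ⊕ n) ℝ}
    (hN : N.IsSymm) (hnonpos : ∀ v : n → ℝ, quad N (Sum.elim 0 v) ≤ 0)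
    (hker : ∀ v : n → ℝ, quad N (Sum.elim 0 v) = 0 → N *ᵥ Sum.elim 0 v = 0)
    {R₁ : Matrix r n ℝ} (hR₁ : SatisfiesQMI N R₁) {A₀ Ψ : Matrix n n ℝ} {E : Matrix n r ℝ}
    {ζ : r → ℝ} (hζ : E *ᵥ ζ ≠ 0) (hΨ : Ψ.PosSemidef)
    (h : ∀ R, SatisfiesQMI N R → ∀ x, x ≠ 0 → quad Ψ ((A₀ + E * R) *ᵥ x) < quad Ψ x) :
    ∃ Φ : Matrix n n ℝ, Φ.PosDef ∧ ∀ x w : n → ℝ, (x ≠ 0 ∨ w ≠ 0) →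
      0 < quad Φ x - quad Φ (A₀ᵀ *ᵥ x + w) - quad N (Sum.elim (Eᵀ *ᵥ x) w) := by
  obtain ⟨hΨs, hΨ0⟩ := posSemidef_iff_quad.mp hΨ
  have hΨd : Ψ.PosDef :=
    posDef_iff_quad.mpr ⟨hΨs, fun x hx => (hΨ0 _).trans_lt (h R₁ hR₁ x hx)⟩
  have hneg : ∀ v : n → ℝ, v ≠ 0 → quad N (Sum.elim 0 v) < 0 := fun v hv =>
    quad_lower_neg_of_lyapunov hN hnonpos hker hR₁ hζ hΨd h hv
  obtain ⟨hΦs, hΦ0⟩ := posDef_iff_quad.mp hΨd.inv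
  set M : Matrix (n ⊕ n) (n ⊕ n) ℝ :=
    (fromCols (1 : Matrix n n ℝ) (0 : Matrix n n ℝ))ᵀ * Ψ⁻¹ *
        fromCols (1 : Matrix n n ℝ) (0 : Matrix n n ℝ) -
      (fromCols A₀ᵀ (1 : Matrix n n ℝ))ᵀ * Ψ⁻¹ * fromCols A₀ᵀ (1 : Matrix n n ℝ) with hM
  have hMs : M.IsSymm := (isSymm_transpose_mul_mul hΦs _).sub (isSymm_transpose_mul_mul hΦs _)
  have hMq : ∀ x w : n → ℝ, quad M (Sum.elim x w) = quad Ψ⁻¹ x - quad Ψ⁻¹ (A₀ᵀ *ᵥ x + w) := by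
    intro x w
    rw [hM, quad_matrix_sub, quad_transpose_mul_mul, quad_transpose_mul_mul]
    simp [fromCols_mulVec]
  set N' : Matrix (n ⊕ n) (n ⊕ n) ℝ :=
    (fromBlocks Eᵀ 0 0 (1 : Matrix n n ℝ))ᵀ * N * fromBlocks Eᵀ 0 0 (1 : Matrix n n ℝ) with hN'
  have hN's : N'.IsSymm := isSymm_transpose_mul_mul hN _
  have hN'q : ∀ x w : n → ℝ, quad N' (Sum.elim x w) = quad N (Sum.elim (Eᵀ *ᵥ x) w) := by
    intro x w
    rw [hN', quad_transpose_mul_mul, fromBlocks_mulVec]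
    simp
  have himp : ∀ z, z ≠ 0 → 0 ≤ quad N' z → 0 < quad M z := by
    intro z hz h0
    obtain ⟨x, w, rfl⟩ : ∃ x w : n → ℝ, z = Sum.elim x w :=
      ⟨z ∘ Sum.inl, z ∘ Sum.inr, (Sum.elim_comp_inl_inr z).symm⟩
    rw [hN'q] at h0
    obtain ⟨R, hR, hRw⟩ := exists_satisfiesQMI_mulVec_eq hN hneg hR₁ h0
    have hx : x ≠ 0 := by
      rintro rfl
      rw [mulVec_zero, mulVec_zero] at hRw
      exact hz (by rw [← hRw, Sum.elim_zero_zero])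
    have h1 := quad_inv_mulVec_lt (A := (A₀ + E * R)ᵀ) hΨd
      (by rw [transpose_transpose]; exact h R hR) hx
    rw [hMq]
    rw [transpose_add, add_mulVec, transpose_mul, ← mulVec_mulVec, hRw] at h1
    linarith
  -- The S-lemma needs a nonzero point with `N' ≥ 0`, supplied by the solution `R₁`, and a point
  -- with `M < 0`, supplied by `(0, E ζ)`.
  have h₀ : 0 ≤ quad N' (Sum.elim (E *ᵥ ζ) (R₁ᵀ *ᵥ (Eᵀ *ᵥ (E *ᵥ ζ)))) := by
    rw [hN'q]
    exact (satisfiesQMI_iff_quad hN R₁).mp hR₁ _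
  have hz₀ : Sum.elim (E *ᵥ ζ) (R₁ᵀ *ᵥ (Eᵀ *ᵥ (E *ᵥ ζ))) ≠ 0 := fun h0 =>
    hζ (by rw [← Sum.elim_comp_inl (E *ᵥ ζ) (R₁ᵀ *ᵥ (Eᵀ *ᵥ (E *ᵥ ζ))), h0]; rfl)
  have h₁ : quad M (Sum.elim 0 (E *ᵥ ζ)) < 0 := by
    rw [hMq, quad_zero, mulVec_zero, zero_add, zero_sub, neg_lt_zero]
    exact hΦ0 _ hζ
  obtain ⟨α, hα, hpos⟩ := exists_pos_quad_sub_smul_pos hMs hN's himp hz₀ h₀ h₁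
  refine ⟨α⁻¹ • Ψ⁻¹, hΨd.inv.smul (inv_pos.mpr hα), fun x w hxw => ?_⟩
  have hne : Sum.elim x w ≠ 0 := by
    intro h0
    rcases hxw with hx | hw
    · exact hx (by rw [← Sum.elim_comp_inl x w, h0]; rfl)
    · exact hw (by rw [← Sum.elim_comp_inr x w, h0]; rfl)
  have h2 := mul_pos (inv_pos.mpr hα) (hpos _ hne)
  rw [quad_matrix_sub, quad_matrix_smul, hMq, hN'q, mul_sub, mul_sub, ← mul_assoc,
    inv_mul_cancel₀ hα.ne', one_mul] at h2
  rw [quad_matrix_smul, quad_matrix_smul]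
  exact h2

/-! ### The linear matrix inequality -/

/-- The terms `Φ(A₀ᵀ x)` in the two squares cancel, which is why the block matrix is linear in `Φ`
and `A₀ * Φ`. -/
theorem quad_lmi {Φ : Matrix n n ℝ} (hΦ : Φ.IsSymm) (A₀ : Matrix n n ℝ) (x w s : n → ℝ) :
    quad (fromBlocks (fromBlocks Φ (-(A₀ * Φ)) (-(A₀ * Φ)ᵀ) (-Φ)) (fromRows (A₀ * Φ) 0)
      (fromCols (A₀ * Φ)ᵀ 0) Φ) (Sum.elim (Sum.elim x w) s) =
    quad Φ x - quad Φ (A₀ᵀ *ᵥ x + w) + quad Φ (A₀ᵀ *ᵥ x + s) := by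
  have h1 : ∀ y, x ⬝ᵥ ((A₀ * Φ) *ᵥ y) = (A₀ᵀ *ᵥ x) ⬝ᵥ (Φ *ᵥ y) := fun y => by
    rw [← mulVec_mulVec, dotProduct_mulVec, mulVec_transpose]
  have h2 : ∀ y, y ⬝ᵥ ((A₀ * Φ)ᵀ *ᵥ x) = (A₀ᵀ *ᵥ x) ⬝ᵥ (Φ *ᵥ y) := fun y => by
    rw [mulVec_transpose, dotProduct_comm, ← dotProduct_mulVec, h1]
  rw [quad_add hΦ, quad_add hΦ]
  simp only [quad, fromBlocks_mulVec, Sum.elim_comp_inl, Sum.elim_comp_inr,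
    sumElim_dotProduct_sumElim, fromRows_mulVec, fromCols_mulVec, dotProduct_add, neg_mulVec,
    dotProduct_neg, h1, h2, zero_mulVec, dotProduct_zero, add_zero]
  ring

theorem posDef_lmi_iff [DecidableEq n] {Φ : Matrix n n ℝ} (hΦ : Φ.PosDef) (A₀ : Matrix n n ℝ)
    {N' : Matrix (n ⊕ n) (n ⊕ n) ℝ} (hN' : N'.IsSymm) :
    (fromBlocks (fromBlocks Φ (-(A₀ * Φ)) (-(A₀ * Φ)ᵀ) (-Φ)) (fromRows (A₀ * Φ) 0)
      (fromCols (A₀ * Φ)ᵀ 0) Φ - fromBlocks N' 0 0 0).PosDef ↔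
    ∀ x w : n → ℝ, (x ≠ 0 ∨ w ≠ 0) →
      0 < quad Φ x - quad Φ (A₀ᵀ *ᵥ x + w) - quad N' (Sum.elim x w) := by
  obtain ⟨hΦs, hΦ0⟩ := posDef_iff_quad.mp hΦ
  have hN0 : ∀ (z : n ⊕ n → ℝ) (s : n → ℝ),
      quad (fromBlocks N' 0 0 (0 : Matrix n n ℝ)) (Sum.elim z s) = quad N' z := by
    intro z s
    simp only [quad, fromBlocks_mulVec, Sum.elim_comp_inl, Sum.elim_comp_inr,
      sumElim_dotProduct_sumElim, zero_mulVec, add_zero, dotProduct_zero]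
  rw [posDef_iff_quad, and_iff_right]
  · constructor
    · intro h x w hxw
      -- A Schur complement done by hand: this choice of third component makes the extra square
      -- vanish.
      have hne : Sum.elim (Sum.elim x w) (-(A₀ᵀ *ᵥ x)) ≠ 0 := by
        intro h0
        rcases hxw with hx | hw
        · exact hx (funext fun i => congrFun h0 (Sum.inl (Sum.inl i)))
        · exact hw (funext fun i => congrFun h0 (Sum.inl (Sum.inr i)))
      have h1 := h _ hne
      rwa [quad_matrix_sub, quad_lmi hΦs, hN0, add_neg_cancel, quad_zero, add_zero] at h1
    · intro h z hz
      obtain ⟨x, w, s, rfl⟩ : ∃ x w s : n → ℝ, z = Sum.elim (Sum.elim x w) s :=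
        ⟨fun i => z (Sum.inl (Sum.inl i)), fun i => z (Sum.inl (Sum.inr i)),
          fun i => z (Sum.inr i), by ext i; rcases i with (i | i) | i <;> rfl⟩
      rw [quad_matrix_sub, quad_lmi hΦs, hN0]
      have hs0 : 0 ≤ quad Φ (A₀ᵀ *ᵥ x + s) := (posSemidef_iff_quad.mp hΦ.posSemidef).2 _
      by_cases hxw : x ≠ 0 ∨ w ≠ 0
      · have := h x w hxw
        linarith
      · push Not at hxw
        obtain ⟨rfl, rfl⟩ := hxw
        have hs : s ≠ 0 := by
          rintro rfl
          exact hz (by rw [Sum.elim_zero_zero, Sum.elim_zero_zero])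
        have := hΦ0 s hs
        simpa [quad_zero, Sum.elim_zero_zero] using this
  · refine IsSymm.sub (IsSymm.fromBlocks (IsSymm.fromBlocks hΦs ?_ ?_) ?_ hΦs)
      (IsSymm.fromBlocks hN' ?_ isSymm_zero)
    · simp
    · simp [IsSymm, hΦs.eq]
    · rw [transpose_fromRows, transpose_zero]
    · simp

end QMI

/-! ### Closed loops -/

section ClosedLoop

variable {m p L : ℕ}

/-- The companion matrix `[J; -C; -R]` of the closed loop. -/
def companionMatrix (C : Matrix (Fin m) (BIdx L m p) ℝ) (R : Matrix (Fin p) (BIdx L m p) ℝ) :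
    Matrix (BIdx L m p) (BIdx L m p) ℝ :=
  blockCol (shiftJ m p L) (-C) (-R)

/-- The coefficient matrix `[-Q_0  P_0  ⋯  -Q_{L-1}  P_{L-1}]` of a system. -/
def ARSystem.coeff (S : ARSystem m p L) : Matrix (Fin p) (BIdx L m p) ℝ :=
  Matrix.of fun b c => Sum.elim (fun a => -S.Q c.1 b a) (fun a => S.P c.1 b a) c.2

/-- The stack `col(z(t), …, z(t+n-1))`. -/
def stack (n : ℕ) (z : ℕ → ZIdx m p → ℝ) (t : ℕ) : BIdx n m p → ℝ :=
  fun r => z (t + r.1) r.2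

/-! ### Companion form of the closed loop -/

theorem blockCol_mul {s s' : Type*} [Fintype s] (X : Matrix (BIdx (L - 1) m p) s ℝ)
    (Y : Matrix (Fin m) s ℝ) (W : Matrix (Fin p) s ℝ) (Z : Matrix s s' ℝ) :
    blockCol (L := L) X Y W * Z = blockCol (X * Z) (Y * Z) (W * Z) := by
  ext ⟨i, a⟩ c
  simp only [blockCol, Matrix.mul_apply, of_apply]
  split_ifs with h
  · rfl
  · cases a <;> simp

theorem blockCol_add {s : Type*} (X X' : Matrix (BIdx (L - 1) m p) s ℝ)
    (Y Y' : Matrix (Fin m) s ℝ) (W W' : Matrix (Fin p) s ℝ) :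
    blockCol (L := L) X Y W + blockCol X' Y' W' = blockCol (X + X') (Y + Y') (W + W') := by
  ext ⟨i, a⟩ c
  simp only [blockCol, Matrix.add_apply, of_apply]
  split_ifs with h
  · rfl
  · cases a <;> simp

/-- The unknown `R` enters only the last `p` rows, which gives the affine form `A₀ + E R` with `E =
(selE m p L)ᵀ`. -/
theorem companionMatrix_eq (C : Matrix (Fin m) (BIdx L m p) ℝ)
    (R : Matrix (Fin p) (BIdx L m p) ℝ) :
    companionMatrix C R = companionMatrix C 0 + (selE m p L)ᵀ * R := by
  rw [selE, transpose_transpose, blockCol_mul, companionMatrix, companionMatrix, blockCol_add]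
  simp

/-- Identifies the block `[JΦ; D; 0]` of the LMI as `A₀ Φ` when `D = -CΦ`. -/
theorem companionMatrix_mul (C : Matrix (Fin m) (BIdx L m p) ℝ)
    (Φ : Matrix (BIdx L m p) (BIdx L m p) ℝ) :
    companionMatrix C 0 * Φ = blockCol (shiftJ m p L * Φ) (-(C * Φ)) 0 := by
  rw [companionMatrix, blockCol_mul]
  simp

theorem selE_transpose_mulVec_ne_zero (hL : 0 < L) {ζ : Fin p → ℝ} (hζ : ζ ≠ 0) :
    (selE m p L)ᵀ *ᵥ ζ ≠ 0 := by
  obtain ⟨b, hb⟩ := Function.ne_iff.mp hζ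
  intro h
  have h1 := congrFun h (⟨L - 1, by omega⟩, Sum.inr b)
  rw [selE, transpose_transpose] at h1
  simp only [mulVec, dotProduct, blockCol, of_apply, lt_irrefl, dite_false, Sum.elim_inr,
    Matrix.neg_apply, Matrix.one_apply] at h1
  simp at h1
  exact hb h1

theorem shiftJ_mulVec (x : BIdx L m p → ℝ) (i : Fin (L - 1)) (a : ZIdx m p) :
    (shiftJ m p L *ᵥ x) (i, a) = x (⟨i + 1, by omega⟩, a) := by
  simp only [mulVec, dotProduct, shiftJ, of_apply]
  rw [Finset.sum_eq_single (⟨i + 1, by omega⟩, a)]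
  · simp
  · rintro ⟨j, b⟩ - hne
    rw [if_neg, zero_mul]
    rintro ⟨h1, h2⟩
    exact hne (Prod.ext (Fin.ext h1) h2)
  · simp

theorem companionMatrix_mulVec_of_lt (C : Matrix (Fin m) (BIdx L m p) ℝ)
    (R : Matrix (Fin p) (BIdx L m p) ℝ) (x : BIdx L m p → ℝ) (i : Fin L) (a : ZIdx m p)
    (h : (i : ℕ) + 1 < L) :
    (companionMatrix C R *ᵥ x) (i, a) = x (⟨i + 1, h⟩, a) := by
  have h' : (i : ℕ) < L - 1 := by omega
  rw [← shiftJ_mulVec x ⟨i, h'⟩ a]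
  simp only [mulVec, companionMatrix, blockCol, of_apply, h', dite_true]

theorem companionMatrix_mulVec_of_eq (C : Matrix (Fin m) (BIdx L m p) ℝ)
    (R : Matrix (Fin p) (BIdx L m p) ℝ) (x : BIdx L m p → ℝ) (i : Fin L) (a : ZIdx m p)
    (h : (i : ℕ) + 1 = L) :
    (companionMatrix C R *ᵥ x) (i, a) = Sum.elim (-(C *ᵥ x)) (-(R *ᵥ x)) a := by
  have h' : ¬ (i : ℕ) < L - 1 := by omega
  rw [← neg_mulVec, ← neg_mulVec]
  simp only [mulVec, companionMatrix, blockCol, of_apply, h', dite_false]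
  cases a <;> rfl

/-! ### Quadratic difference forms along trajectories -/

theorem quad_padFirst {n : ℕ} (Ψ : Matrix (BIdx n m p) (BIdx n m p) ℝ)
    (v : BIdx (n + 1) m p → ℝ) :
    quad (padFirst Ψ) v = quad Ψ fun r => v (r.1.succ, r.2) := by
  simp only [quad, dotProduct, mulVec, Fintype.sum_prod_type, padFirst, of_apply]
  simp [Fin.sum_univ_succ]

theorem quad_padLast {n : ℕ} (Ψ : Matrix (BIdx n m p) (BIdx n m p) ℝ)
    (v : BIdx (n + 1) m p → ℝ) :
    quad (padLast Ψ) v = quad Ψ fun r => v (r.1.castSucc, r.2) := by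
  simp only [quad, dotProduct, mulVec, Fintype.sum_prod_type, padLast, of_apply]
  simp [Fin.sum_univ_castSucc]

theorem qdf_eq_quad {n : ℕ} (Ψ : Matrix (BIdx n m p) (BIdx n m p) ℝ) (z : ℕ → ZIdx m p → ℝ)
    (t : ℕ) : qdf Ψ z t = quad Ψ (stack n z t) := by
  simp only [qdf, quad, dotProduct, mulVec, Fintype.sum_prod_type, stack, of_apply,
    Finset.mul_sum]
  refine Finset.sum_congr rfl fun k _ => ?_
  rw [Finset.sum_comm]

theorem qdf_nablaQ {n : ℕ} (Ψ : Matrix (BIdx n m p) (BIdx n m p) ℝ) (z : ℕ → ZIdx m p → ℝ)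
    (t : ℕ) : qdf (nablaQ Ψ) z t = quad Ψ (stack n z (t + 1)) - quad Ψ (stack n z t) := by
  rw [qdf_eq_quad, nablaQ, quad_matrix_sub, quad_padFirst, quad_padLast]
  congr 2
  funext r
  simp only [stack, Fin.val_succ]
  congr 1
  omega

/-- In `col(x, -Cx, -Rx)`, dropping the first block leaves the companion matrix applied to `x`, and
dropping the last block leaves `x`. -/
theorem quad_loopMatrix (C : Matrix (Fin m) (BIdx L m p) ℝ) (R : Matrix (Fin p) (BIdx L m p) ℝ)
    (Ψ : Matrix (BIdx L m p) (BIdx L m p) ℝ) (x : BIdx L m p → ℝ) :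
    quad ((loopMatrix C R)ᵀ * nablaQ Ψ * loopMatrix C R) x =
      quad Ψ (companionMatrix C R *ᵥ x) - quad Ψ x := by
  have hcast : ∀ (i : Fin L) (a : ZIdx m p), (loopMatrix C R *ᵥ x) (i.castSucc, a) = x (i, a) := by
    intro i a
    have : (fun c => loopMatrix C R (i.castSucc, a) c) =
        (1 : Matrix (BIdx L m p) (BIdx L m p) ℝ) (i, a) := by
      funext c
      simp [loopMatrix]
    exact (congrArg (· ⬝ᵥ x) this).trans (congrFun (one_mulVec x) (i, a))
  have hlast : ∀ a : ZIdx m p,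
      (loopMatrix C R *ᵥ x) (Fin.last L, a) = Sum.elim (-(C *ᵥ x)) (-(R *ᵥ x)) a := by
    intro a
    rw [← neg_mulVec, ← neg_mulVec]
    simp only [mulVec, loopMatrix, of_apply, Fin.lastCases_last]
    cases a <;> rfl
  rw [quad_transpose_mul_mul, nablaQ, quad_matrix_sub, quad_padFirst, quad_padLast]
  simp only [hcast]
  congr 2
  funext ⟨i, a⟩
  by_cases h : (i : ℕ) + 1 < L
  · rw [companionMatrix_mulVec_of_lt C R x i a h, ← hcast]
    rfl
  · have h' : (i : ℕ) + 1 = L := by omega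
    rw [companionMatrix_mulVec_of_eq C R x i a h', ← hlast]
    congr 2
    exact Fin.ext h'

/-- All blocks but the last are shifts; the last one is the controller equation stacked on the
noise-free system equation. -/
theorem stack_succ_of_mem {C : Matrix (Fin m) (BIdx L m p) ℝ} {S : ARSystem m p L}
    {z : ℕ → ZIdx m p → ℝ} (hz : z ∈ closedLoopBehavior (ARController.ofCoeff C) S) (t : ℕ) :
    stack L z (t + 1) = companionMatrix C S.coeff *ᵥ stack L z t := by
  obtain ⟨hK, hS⟩ := hz
  funext ⟨i, a⟩
  by_cases h : (i : ℕ) + 1 < L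
  · rw [companionMatrix_mulVec_of_lt _ _ _ i a h]
    simp only [stack]
    congr 1
    omega
  · have h' : (i : ℕ) + 1 = L := by omega
    rw [companionMatrix_mulVec_of_eq _ _ _ i a h']
    have ht : stack L z (t + 1) (i, a) = z (t + L) a := by
      simp only [stack]
      congr 1
      omega
    rw [ht]
    cases a with
    | inl a =>
      have h1 := congrFun (hK t) a
      simp only [ARController.ofCoeff, Pi.add_apply, Finset.sum_apply, mulVec, dotProduct,
        of_apply, neg_mul, Finset.sum_neg_distrib] at h1
      simp only [Sum.elim_inl, Pi.neg_apply, mulVec, dotProduct, Fintype.sum_prod_type,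
        Fintype.sum_sum_type, stack, Finset.sum_add_distrib]
      linarith
    | inr b =>
      have h1 := congrFun (hS t) b
      simp only [Pi.add_apply, Finset.sum_apply, mulVec, dotProduct, Pi.zero_apply,
        add_zero] at h1
      simp only [Sum.elim_inr, Pi.neg_apply, mulVec, dotProduct, Fintype.sum_prod_type,
        Fintype.sum_sum_type, stack, ARSystem.coeff, of_apply, Sum.elim_inl, neg_mul,
        Finset.sum_neg_distrib, Finset.sum_add_distrib]
      linarith

theorem stabilizes_and_isLyapunovOn (hL : 0 < L) {C : Matrix (Fin m) (BIdx L m p) ℝ}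
    {S : ARSystem m p L} {Ψ : Matrix (BIdx L m p) (BIdx L m p) ℝ} (hΨ : Ψ.PosDef)
    (h : ∀ x, x ≠ 0 → quad Ψ (companionMatrix C S.coeff *ᵥ x) < quad Ψ x) :
    (ARController.ofCoeff C).Stabilizes S ∧
      IsLyapunovOn Ψ (closedLoopBehavior (ARController.ofCoeff C) S) := by
  obtain ⟨hΨs, hΨ0⟩ := posSemidef_iff_quad.mp hΨ.posSemidef
  set A := companionMatrix C S.coeff with hA
  have hle : ∀ x, quad Ψ (A *ᵥ x) ≤ quad Ψ x := by
    intro x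
    by_cases hx : x = 0
    · rw [hx, mulVec_zero]
    · exact (h x hx).le
  refine ⟨fun z hz => ?_, fun z _ t => ?_, fun z hz t => ?_, fun z hz => ⟨fun h0 => ?_, ?_⟩⟩
  · have hstep := fun t => stack_succ_of_mem hz t
    -- By compactness each step loses at least `c |x|²`. The values of `Ψ` are antitone and bounded
    -- below, hence convergent, so the losses tend to zero and force the state to zero.
    obtain ⟨c, hc, hcle⟩ := exists_pos_mul_le_quad (M := Ψ - Aᵀ * Ψ * A) fun x hx => by
      rw [quad_matrix_sub, quad_transpose_mul_mul, sub_pos]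
      exact h x hx
    have hanti : Antitone fun t => quad Ψ (stack L z t) := antitone_nat_of_succ_le fun t => by
      simp only [hstep t]
      exact hle _
    obtain ⟨l, hl⟩ : ∃ l, Tendsto (fun t => quad Ψ (stack L z t)) atTop (𝓝 l) :=
      ⟨_, tendsto_atTop_ciInf hanti ⟨0, by rintro _ ⟨t, rfl⟩; exact hΨ0 _⟩⟩
    have hdiff : Tendsto (fun t => (quad Ψ (stack L z t) - quad Ψ (stack L z (t + 1))) / c)
        atTop (𝓝 0) := by
      have := (hl.sub (hl.comp (tendsto_add_atTop_nat 1))).div_const c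
      simpa using this
    rw [tendsto_pi_nhds]
    intro a
    have hsq : Tendsto (fun t => z t a ^ 2) atTop (𝓝 0) := by
      refine squeeze_zero (fun t => sq_nonneg _) (fun t => ?_) hdiff
      have h1 := hcle (stack L z t)
      rw [quad_matrix_sub, quad_transpose_mul_mul, ← hstep t] at h1
      rw [le_div_iff₀ hc]
      refine le_trans ?_ h1
      rw [mul_comm]
      refine mul_le_mul_of_nonneg_left ?_ hc.le
      have h2 := Finset.single_le_sum
        (f := fun r : BIdx L m p => stack L z t r * stack L z t r)
        (fun j _ => mul_self_nonneg _) (Finset.mem_univ (⟨0, hL⟩, a))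
      simpa [stack, sq, dotProduct] using h2
    have habs := hsq.sqrt
    simp only [Real.sqrt_sq_eq_abs, Real.sqrt_zero] at habs
    exact (tendsto_zero_iff_abs_tendsto_zero _).mpr habs
  · rw [qdf_eq_quad]
    exact hΨ0 _
  · rw [qdf_nablaQ, stack_succ_of_mem hz]
    exact sub_nonpos.mpr (hle _)
  · funext t a
    have h1 := h0 t
    rw [qdf_nablaQ, stack_succ_of_mem hz, sub_eq_zero] at h1
    -- Strict decrease off zero means that a vanishing increment forces a zero state; block 0 of the
    -- state is `z t`.
    have h2 : stack L z t = 0 := by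
      by_contra hne
      exact absurd h1 (h _ hne).ne
    exact congrFun h2 (⟨0, hL⟩, a)
  · rintro rfl t
    rw [qdf_nablaQ]
    have : ∀ s, stack L (0 : ℕ → ZIdx m p → ℝ) s = 0 := fun s => rfl
    rw [this, this, sub_self]

/-! ### Data -/

/-- Column `j` is the system equation at time `j`, solved for the noise. -/
theorem noiseMatrix_eq {T : ℕ} (hLT : L ≤ T) {u : Fin (T + 1) → Fin m → ℝ}
    {y : Fin (T + 1) → Fin p → ℝ} {S : ARSystem m p L} {us : ℕ → Fin m → ℝ}
    {ys v : ℕ → Fin p → ℝ} (hS : S.IsSolution us ys v) (hu : ∀ t : Fin (T + 1), us t = u t)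
    (hy : ∀ t : Fin (T + 1), ys t = y t) :
    noiseMatrix L T v = hankelTwo hLT y + S.coeff * hankelOne hLT u y := by
  ext b j
  have h1 := congrFun (hS j) b
  have hu' : ∀ (i : Fin L), u ⟨i + j, by omega⟩ = us (j + i) := fun i =>
    (hu ⟨i + j, by omega⟩).symm.trans (congrArg us (add_comm _ _))
  have hy' : ∀ (i : Fin L), y ⟨i + j, by omega⟩ = ys (j + i) := fun i =>
    (hy ⟨i + j, by omega⟩).symm.trans (congrArg ys (add_comm _ _))
  have hy'' : y ⟨L + j, by omega⟩ = ys (j + L) :=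
    (hy ⟨L + j, by omega⟩).symm.trans (congrArg ys (add_comm _ _))
  simp only [Pi.add_apply, Finset.sum_apply, mulVec, dotProduct] at h1
  simp only [noiseMatrix, hankelTwo, hankelOne, Matrix.add_apply, Matrix.mul_apply, of_apply,
    Fintype.sum_prod_type, Fintype.sum_sum_type, ARSystem.coeff, Sum.elim_inl, Sum.elim_inr,
    hu', hy', hy'', neg_mul, Finset.sum_neg_distrib, Finset.sum_add_distrib]
  linarith

/-- Since `V = H₂ + R H₁`, the transposed data block maps `[I; Rᵀ]` to `[I; Vᵀ]`, so the noise QMI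
becomes the QMI of `N`. -/
theorem satisfiesQMI_dataN_of_isConsistent {T : ℕ} (hLT : L ≤ T)
    {Θ : Matrix (Fin p ⊕ Fin (T - L + 1)) (Fin p ⊕ Fin (T - L + 1)) ℝ}
    {u : Fin (T + 1) → Fin m → ℝ} {y : Fin (T + 1) → Fin p → ℝ} {S : ARSystem m p L}
    (h : IsConsistent Θ u y S) : SatisfiesQMI (dataN hLT Θ u y) S.coeff := by
  obtain ⟨us, ys, v, hS, hu, hy, hv⟩ := h
  have hV := noiseMatrix_eq hLT hS hu hy
  have hrows : (dataBlock hLT u y)ᵀ * fromRows (1 : Matrix (Fin p) (Fin p) ℝ) S.coeffᵀ =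
      fromRows (1 : Matrix (Fin p) (Fin p) ℝ) (noiseMatrix L T v)ᵀ := by
    rw [hV, dataBlock, fromBlocks_transpose, fromBlocks_mul_fromRows]
    simp [transpose_add, transpose_mul]
  have hrows' : (fromRows (1 : Matrix (Fin p) (Fin p) ℝ) S.coeffᵀ)ᵀ * dataBlock hLT u y =
      (fromRows (1 : Matrix (Fin p) (Fin p) ℝ) (noiseMatrix L T v)ᵀ)ᵀ := by
    rw [← hrows, transpose_mul, transpose_transpose]
  unfold SatisfiesQMI at hv ⊢
  rw [dataN, ← Matrix.mul_assoc, ← Matrix.mul_assoc, hrows', Matrix.mul_assoc, hrows]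
  exact hv

/-- With `w = H₁ᵀ v`, the form reduces to `Θ₂₂` at `w`. By semidefiniteness a zero value puts `w` in
`ker Θ₂₂`, hence in `ker Θ₁₂`, so `Θ` kills `(0, w)`. -/
theorem dataN_lower_nonpos_and_ker {T : ℕ} (hLT : L ≤ T)
    {Θ : Matrix (Fin p ⊕ Fin (T - L + 1)) (Fin p ⊕ Fin (T - L + 1)) ℝ} (hΘ : IsQMIClass Θ)
    (u : Fin (T + 1) → Fin m → ℝ) (y : Fin (T + 1) → Fin p → ℝ) (v : BIdx L m p → ℝ) :
    quad (dataN hLT Θ u y) (Sum.elim 0 v) ≤ 0 ∧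
      (quad (dataN hLT Θ u y) (Sum.elim 0 v) = 0 → dataN hLT Θ u y *ᵥ Sum.elim 0 v = 0) := by
  obtain ⟨-, hneg, -, hker⟩ := hΘ
  have hD : (dataBlock hLT u y)ᵀ *ᵥ Sum.elim 0 v = Sum.elim (0 : Fin p → ℝ) ((hankelOne hLT u y)ᵀ *ᵥ v) := by
    rw [dataBlock, fromBlocks_transpose, fromBlocks_mulVec]
    simp
  set w := (hankelOne hLT u y)ᵀ *ᵥ v
  have hΘw : Θ *ᵥ Sum.elim 0 w = Sum.elim (Θ.toBlocks₁₂ *ᵥ w) (Θ.toBlocks₂₂ *ᵥ w) := by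
    conv_lhs => rw [← fromBlocks_toBlocks Θ]
    rw [fromBlocks_mulVec]
    simp
  have hq : quad (dataN hLT Θ u y) (Sum.elim 0 v) = quad Θ.toBlocks₂₂ w := by
    rw [dataN, quad_mul_mul_transpose, hD, quad, hΘw]
    simp [quad]
  have hnonneg := (posSemidef_iff_quad.mp hneg).2 w
  rw [quad_matrix_neg] at hnonneg
  refine ⟨by rw [hq]; linarith, fun h0 => ?_⟩
  have h1 : Θ.toBlocks₂₂ *ᵥ w = 0 := by
    have := (hneg.dotProduct_mulVec_zero_iff w).mp (by
      rw [hq, quad] at h0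
      simp [neg_mulVec, h0])
    simpa [neg_mulVec] using this
  rw [dataN, ← mulVec_mulVec, hD, ← mulVec_mulVec, hΘw, h1, hker w h1, Sum.elim_zero_zero,
    mulVec_zero]

theorem satisfiesLMI_iff {T : ℕ} (hLT : L ≤ T)
    {Θ : Matrix (Fin p ⊕ Fin (T - L + 1)) (Fin p ⊕ Fin (T - L + 1)) ℝ} (hΘ : Θ.IsSymm)
    (u : Fin (T + 1) → Fin m → ℝ) (y : Fin (T + 1) → Fin p → ℝ)
    (C : Matrix (Fin m) (BIdx L m p) ℝ) {Φ : Matrix (BIdx L m p) (BIdx L m p) ℝ}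
    (hΦ : Φ.PosDef) :
    SatisfiesLMI hLT Θ u y (-(C * Φ)) Φ ↔ ∀ x w : BIdx L m p → ℝ, (x ≠ 0 ∨ w ≠ 0) →
      0 < quad Φ x - quad Φ ((companionMatrix C 0)ᵀ *ᵥ x + w) -
        quad (dataN hLT Θ u y) (Sum.elim (selE m p L *ᵥ x) w) := by
  have hN : (dataN hLT Θ u y).IsSymm := isSymm_mul_mul_transpose hΘ _
  have hNbar : ∀ x w : BIdx L m p → ℝ, quad (dataNbar hLT Θ u y) (Sum.elim x w) =
      quad (dataN hLT Θ u y) (Sum.elim (selE m p L *ᵥ x) w) := by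
    intro x w
    rw [dataNbar, quad_transpose_mul_mul, selBlock, fromBlocks_mulVec]
    simp
  rw [SatisfiesLMI, ← companionMatrix_mul,
    posDef_lmi_iff hΦ _ (N' := dataNbar hLT Θ u y) (isSymm_transpose_mul_mul hN _)]
  simp only [hNbar]

end ClosedLoop

/-! ### Equivalence and the resulting controller -/

theorem mainTheorem4 (m p L T : ℕ) (hm : 0 < m) (hp : 0 < p) (hL : 0 < L) (hLT : L ≤ T)
    (Θ : Matrix (Fin p ⊕ Fin (T - L + 1)) (Fin p ⊕ Fin (T - L + 1)) ℝ) (hΘ : IsQMIClass Θ)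
    (u : Fin (T + 1) → Fin m → ℝ) (y : Fin (T + 1) → Fin p → ℝ)
    (Strue : ARSystem m p L) (hdata : IsConsistent Θ u y Strue)
    (hrank : (hankelOne hLT u y).rank = (m + p) * L) :
    (IsInformative hLT Θ u y ↔
      ∃ (D : Matrix (Fin m) (BIdx L m p) ℝ) (Φ : Matrix (BIdx L m p) (BIdx L m p) ℝ),
        Φ.PosDef ∧ SatisfiesLMI hLT Θ u y D Φ) ∧
    ∀ (D : Matrix (Fin m) (BIdx L m p) ℝ) (Φ : Matrix (BIdx L m p) (BIdx L m p) ℝ),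
      Φ.PosDef → SatisfiesLMI hLT Θ u y D Φ →
        ∀ S : ARSystem m p L, IsConsistent Θ u y S →
          (ARController.ofCoeff (-(D * Φ⁻¹))).Stabilizes S ∧
          IsLyapunovOn Φ⁻¹ (closedLoopBehavior (ARController.ofCoeff (-(D * Φ⁻¹))) S) := by
  have hN : (dataN hLT Θ u y).IsSymm := isSymm_mul_mul_transpose hΘ.1 _
  -- Shared by sufficiency and by the closed-loop claims: both need the decrease of `Φ⁻¹` for every
  -- solution of the QMI.
  have hdecr : ∀ (D : Matrix (Fin m) (BIdx L m p) ℝ) (Φ : Matrix (BIdx L m p) (BIdx L m p) ℝ),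
      Φ.PosDef → SatisfiesLMI hLT Θ u y D Φ → ∀ R, SatisfiesQMI (dataN hLT Θ u y) R →
        ∀ x, x ≠ 0 → quad Φ⁻¹ (companionMatrix (-(D * Φ⁻¹)) R *ᵥ x) < quad Φ⁻¹ x := by
    intro D Φ hΦ hLMI R hR x hx
    have hdet : IsUnit Φ.det := (isUnit_iff_isUnit_det Φ).mp hΦ.isUnit
    have hD : D = -(-(D * Φ⁻¹) * Φ) := by
      rw [Matrix.neg_mul, neg_neg, Matrix.mul_assoc, nonsing_inv_mul _ hdet, Matrix.mul_one]
    set C := -(D * Φ⁻¹)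
    rw [hD, satisfiesLMI_iff hLT hΘ.1 u y C hΦ] at hLMI
    refine quad_inv_mulVec_lt hΦ (fun ξ hξ => ?_) hx
    -- At this `w` the form of `N` is nonnegative because `R` is a solution, so the LMI bounds `Φ`
    -- along the transposed companion matrix.
    have h1 := hLMI ξ (Rᵀ *ᵥ (selE m p L *ᵥ ξ)) (Or.inl hξ)
    have h2 := (satisfiesQMI_iff_quad hN R).mp hR (selE m p L *ᵥ ξ)
    rw [companionMatrix_eq, transpose_add, add_mulVec, transpose_mul, transpose_transpose,
      ← mulVec_mulVec]
    linarith
  refine ⟨⟨?_, ?_⟩, ?_⟩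
  · rintro ⟨C, Ψ, hΨ, h⟩
    obtain ⟨ζ, hζ⟩ : ∃ ζ : Fin p → ℝ, ζ ≠ 0 :=
      ⟨fun _ => 1, fun h0 => one_ne_zero (congrFun h0 ⟨0, hp⟩)⟩
    obtain ⟨Φ, hΦ, hΦpos⟩ := exists_posDef_of_lyapunov hN
      (fun v => (dataN_lower_nonpos_and_ker hLT hΘ u y v).1)
      (fun v => (dataN_lower_nonpos_and_ker hLT hΘ u y v).2)
      (satisfiesQMI_dataN_of_isConsistent hLT hdata) (A₀ := companionMatrix C 0)
      (selE_transpose_mulVec_ne_zero hL hζ) hΨ (fun R hR x hx => by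
        have h1 := (posDef_iff_quad.mp (h R hR)).2 x hx
        rw [quad_matrix_neg, quad_loopMatrix] at h1
        rw [← companionMatrix_eq]
        linarith)
    exact ⟨-(C * Φ), Φ, hΦ, (satisfiesLMI_iff hLT hΘ.1 u y C hΦ).mpr hΦpos⟩
  · rintro ⟨D, Φ, hΦ, hLMI⟩
    refine ⟨-(D * Φ⁻¹), Φ⁻¹, hΦ.inv.posSemidef, fun R hR => ?_⟩
    have hs : (Φ⁻¹).IsSymm := (posDef_iff_quad.mp hΦ.inv).1
    refine posDef_iff_quad.mpr ⟨(isSymm_transpose_mul_mul ?_ _).neg, fun x hx => ?_⟩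
    · refine IsSymm.sub (IsSymm.ext fun r c => ?_) (IsSymm.ext fun r c => ?_)
      · obtain ⟨i, a⟩ := r
        obtain ⟨j, b⟩ := c
        cases i using Fin.cases <;> cases j using Fin.cases <;> simp [padFirst, hs.apply]
      · obtain ⟨i, a⟩ := r
        obtain ⟨j, b⟩ := c
        cases i using Fin.lastCases <;> cases j using Fin.lastCases <;> simp [padLast, hs.apply]
    · rw [quad_matrix_neg, quad_loopMatrix]
      have := hdecr D Φ hΦ hLMI R hR x hx
      linarith
  · intro D Φ hΦ hLMI S hS
    exact stabilizes_and_isLyapunovOn hL hΦ.inv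
      (hdecr D Φ hΦ hLMI _ (satisfiesQMI_dataN_of_isConsistent hLT hS))
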